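/- Let $p$ be a prime. Let $\mathcal G$ be a finite directed graph with vertex set $V$ whose edges carry labels from a finite alphabet $\mathcal A$ (formally, the edge set is a subset of $V\times V\times\mathcal A$, so loops, and several edges between the same vertices with different labels, are allowed), let $v_0\in V$, and let $\bar f_p:\mathcal A\to\{0,1,\dots,p-1\}$ be a digit assignment map. Let $X_{\mathcal G}(v_0)\subset\mathcal A^{\mathbb N}$ be the set of label sequences of all one-sided infinite walks in $\mathcal G$ starting at $v_0$, let $f_p:\mathcal A^{\mathbb N}\to\mathbb Z_p$ be the map $f_p(a_0,a_1,\dots)=\sum_{k\ge 0}\bar f_p(a_k)p^k$, and suppose that $Y=f_p(X_{\mathcal G}(v_0))\subset\mathbb Z_p$ is nonempty. Suppose that $(\bar f_p,\mathcal G,v_0)$ is a standard presentation of $Y$, that is: $\bar f_p$ is injective; at each vertex of $\mathcal G$ all exiting edges have different labels; and every vertex of $\mathcal G$ can be reached from $v_0$ by a directed path. Then the Hausdorff dimension of $Y$ with respect to the $p$-adic metric is $$d_H(Y)=\log_p\sigma(A)=\frac{\log\sigma(A)}{\log p},$$ where $\sigma(A)$ is the spectral radius of the adjacency matrix $A=[a_{i,j}]_{i,j\in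 V}$ of $\mathcal G$, in which $a_{i,j}$ is the number of directed edges from vertex $i$ to vertex $j$. -/

import Mathlib

open scoped ENNReal

/-- An edge-labeled directed graph on the vertex set `V` with labels in the alphabet `A`:
the edge `(i, j, a)` runs from `i` to `j` and carries the label `a`. Loops are allowed, and so
are several edges from `i` to `j` with different labels. -/
structure LabeledDigraph (V A : Type*) where
  edges : Set (V × V × A)

namespace LabeledDigraph

variable {V A : Type*}

/-- The path set `X_G(v)`: the label sequences of all one-sided infinite walks issuing
from `v`. -/
def pathSet (G : LabeledDigraph V A) (v : V) : Set (ℕ → A) :=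
  {a | ∃ w : ℕ → V, w 0 = v ∧ ∀ n, (w n, w (n + 1), a n) ∈ G.edges}

/-- At each vertex, all exiting edges have different labels. -/
def RightResolving (G : LabeledDigraph V A) : Prop :=
  ∀ (i j k : V) (a : A), (i, j, a) ∈ G.edges → (i, k, a) ∈ G.edges → j = k

/-- Every vertex can be reached from `v` by a directed path (possibly of length zero). -/
def Reachable (G : LabeledDigraph V A) (v : V) : Prop :=
  ∀ w : V, Relation.ReflTransGen (fun i j => ∃ a, (i, j, a) ∈ G.edges) v w

/-- The adjacency matrix of the underlying directed graph: its `(i, j)` entry counts the directed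
edges from `i` to `j`. -/
noncomputable def adjMatrix (G : LabeledDigraph V A) : Matrix V V ℕ :=
  Matrix.of fun i j => {a : A | (i, j, a) ∈ G.edges}.ncard

end LabeledDigraph

/-- The map `A^ℕ → ℤ_p` induced by a digit assignment map `f : A → {0, …, p - 1}`: it sends
`(a₀, a₁, …)` to the `p`-adic integer `∑ f(a_k) p^k`. -/
noncomputable def digitExpansion (p : ℕ) [Fact p.Prime] {A : Type*} (f : A → Fin p)
    (a : ℕ → A) : ℤ_[p] :=
  ∑' k, ((f (a k) : ℕ) : ℤ_[p]) * (p : ℤ_[p]) ^ k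

/-- The series defining `digitExpansion` always converges. -/
theorem summable_digitExpansion (p : ℕ) [Fact p.Prime] {A : Type*} (f : A → Fin p)
    (a : ℕ → A) : Summable fun k => ((f (a k) : ℕ) : ℤ_[p]) * (p : ℤ_[p]) ^ k := by
  have hp : (1 : ℝ) < p := by exact_mod_cast (Fact.out : p.Prime).one_lt
  refine Summable.of_norm_bounded (g := fun k : ℕ => ((p : ℝ)⁻¹) ^ k)
    (summable_geometric_of_lt_one (by positivity) (inv_lt_one_of_one_lt₀ hp)) fun k => ?_
  rw [norm_mul, norm_pow, PadicInt.norm_p]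
  exact mul_le_of_le_one_left (by positivity) (PadicInt.norm_le_one _)

/-- `(f, G, v)` is a presentation of `Y ⊆ ℤ_p`, that is, `Y` is the image of the path set `X_G(v)`,
and this presentation is standard: injective, right-resolving and reachable. -/
structure IsStandardPresentation (p : ℕ) [Fact p.Prime] {V A : Type*} (Y : Set ℤ_[p])
    (f : A → Fin p) (G : LabeledDigraph V A) (v : V) : Prop where
  eq_image : Y = digitExpansion p f '' G.pathSet v
  injective : Function.Injective f
  rightResolving : G.RightResolving
  reachable : G.Reachable v

open MeasureTheory Filter
open scoped NNReal Topology

/-! ### The p-adic metric on digit expansions. -/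

section DigitExpansion

variable (p : ℕ) [Fact p.Prime] {A : Type*} (f : A → Fin p)

/-! Let `σ` be the spectral radius. Upper bound: walks of length `n` index a cover by balls of
radius `p ^ (-n)`, and by Gelfand's formula they number at most `r ^ n` eventually, for any `r > σ`;
hence `μH[s] = 0` once `p ^ s > σ` (`dimH_image_le`).

Lower bound: the moduli of a top eigenvector satisfy `σ * x ≤ A x`, so no irreducibility or Perron
vector is needed. Where `x v ≠ 0`, a cover of too small total `s`-size, with `p ^ s = σ`, is evaded
by a greedily chosen walk (`exists_mem_pathSet_avoiding`), so `μH[s] ≠ 0`. Reachability carries the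
bound from `v` to `v₀`. -/

theorem digitExpansion_eq_head_add (a : ℕ → A) :
    digitExpansion p f a =
      ((f (a 0) : ℕ) : ℤ_[p]) + p * digitExpansion p f (fun k => a (k + 1)) := by
  unfold digitExpansion
  rw [(summable_digitExpansion p f a).tsum_eq_zero_add,
    ← (summable_digitExpansion p f fun k => a (k + 1)).tsum_mul_left]
  simp only [pow_zero, mul_one]
  congr 2
  ext1 k
  ring

theorem PadicInt.norm_p_mul (x : ℤ_[p]) : ‖(p : ℤ_[p]) * x‖ = (p : ℝ)⁻¹ * ‖x‖ := by
  rw [norm_mul, PadicInt.norm_p]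

theorem PadicInt.eq_of_norm_digit_sub_lt_one (i j : Fin p)
    (h : ‖((i : ℕ) : ℤ_[p]) - ((j : ℕ) : ℤ_[p])‖ < 1) : i = j := by
  have h1 : ‖(((i : ℕ) - (j : ℕ) : ℤ) : ℤ_[p])‖ < 1 := by simpa using h
  rw [PadicInt.norm_int_lt_one_iff_dvd] at h1
  have h2 := Int.eq_zero_of_abs_lt_dvd h1 (by rw [abs_lt]; omega)
  ext
  omega

variable {f}

/-- Two digit expansions that are `p ^ (-n)`-close have the same first `n` digits. -/
theorem eq_of_norm_digitExpansion_sub_le (hf : Function.Injective f) (n : ℕ) :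
    ∀ a b : ℕ → A, ‖digitExpansion p f a - digitExpansion p f b‖ ≤ ((p : ℝ)⁻¹) ^ n →
      ∀ k < n, a k = b k := by
  have hp : (1 : ℝ) < p := by exact_mod_cast (Fact.out : p.Prime).one_lt
  have hp' : (p : ℝ)⁻¹ < 1 := inv_lt_one_of_one_lt₀ hp
  induction n with
  | zero => intro a b _ k hk; omega
  | succ n ih =>
    intro a b hab k hk
    rw [digitExpansion_eq_head_add p f a, digitExpansion_eq_head_add p f b] at hab
    set x := digitExpansion p f (fun k => a (k + 1))
    set y := digitExpansion p f (fun k => b (k + 1))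
    have hpow : ((p : ℝ)⁻¹) ^ (n + 1) < 1 := pow_lt_one₀ (by positivity) hp' (by omega)
    have hxy : ‖(p : ℤ_[p]) * (x - y)‖ < 1 := by
      rw [PadicInt.norm_p_mul]
      have := PadicInt.norm_le_one (x - y)
      calc (p : ℝ)⁻¹ * ‖x - y‖ ≤ (p : ℝ)⁻¹ * 1 := by gcongr
        _ < 1 := by simpa using hp'
    have h0 : f (a 0) = f (b 0) := by
      apply PadicInt.eq_of_norm_digit_sub_lt_one
      have e : ((f (a 0) : ℕ) : ℤ_[p]) - ((f (b 0) : ℕ) : ℤ_[p]) =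
          ((f (a 0) : ℕ) + p * x - ((f (b 0) : ℕ) + p * y)) - p * (x - y) := by ring
      rw [e, sub_eq_add_neg]
      refine (PadicInt.nonarchimedean _ _).trans_lt (max_lt (hab.trans_lt hpow) ?_)
      rwa [norm_neg]
    rcases k with _ | k
    · exact hf h0
    · refine ih (fun k => a (k + 1)) (fun k => b (k + 1)) ?_ k (by omega)
      have e : ((f (a 0) : ℕ) : ℤ_[p]) + p * x - ((f (b 0) : ℕ) + p * y) = p * (x - y) := by
        rw [h0]; ring
      rw [e, PadicInt.norm_p_mul, pow_succ', mul_le_mul_iff_right₀ (by positivity)] at hab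
      exact hab

/-- Prepending a digit is an expanding map up to the factor `p`. -/
theorem antilipschitzWith_add_p_mul (c : ℤ_[p]) :
    AntilipschitzWith (p : ℝ≥0) fun x : ℤ_[p] => c + p * x := by
  have hp : (0 : ℝ) < p := by exact_mod_cast (Fact.out : p.Prime).pos
  refine AntilipschitzWith.of_le_mul_dist fun x y => ?_
  rw [dist_eq_norm, dist_eq_norm, add_sub_add_left_eq_sub, ← mul_sub, PadicInt.norm_p_mul]
  simp [hp.ne']

end DigitExpansion

/-! ### Walks, covers by balls, and dimension along edges. -/

namespace LabeledDigraph

variable {V A : Type*} (G : LabeledDigraph V A)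

theorem cons_mem_pathSet {v w : V} {a : A} (h : (v, w, a) ∈ G.edges) {b : ℕ → A}
    (hb : b ∈ G.pathSet w) : (fun n => Nat.casesOn n a b : ℕ → A) ∈ G.pathSet v := by
  obtain ⟨u, hu0, hu⟩ := hb
  refine ⟨fun n => Nat.casesOn n v u, rfl, fun n => ?_⟩
  rcases n with _ | n
  · simpa [hu0] using h
  · exact hu n

theorem exists_edge_of_mem_pathSet {v : V} {a : ℕ → A} (ha : a ∈ G.pathSet v) :
    ∃ w, (v, w, a 0) ∈ G.edges ∧ (fun n => a (n + 1)) ∈ G.pathSet w := by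
  obtain ⟨u, hu0, hu⟩ := ha
  exact ⟨u 1, by simpa [hu0] using hu 0, fun n => u (n + 1), rfl, fun n => hu (n + 1)⟩

open Classical in
/-- The edges leaving `v`, as pairs of a target and a label. -/
noncomputable def exits [Fintype V] [Fintype A] (v : V) : Finset (V × A) :=
  {q | (v, q.1, q.2) ∈ G.edges}

theorem mem_exits [Fintype V] [Fintype A] {v : V} {q : V × A} :
    q ∈ G.exits v ↔ (v, q.1, q.2) ∈ G.edges := by simp [exits]

theorem sum_exits [Fintype V] [Fintype A] {M : Type*} [Semiring M] (v : V) (g : V → M) :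
    ∑ q ∈ G.exits v, g q.1 = ∑ w, (G.adjMatrix v w : M) * g w := by
  classical
  rw [exits, Finset.sum_filter, Fintype.sum_prod_type]
  refine Finset.sum_congr rfl fun w _ => ?_
  dsimp only
  rw [← Finset.sum_filter, Finset.sum_const, nsmul_eq_mul]
  congr 2
  simp [adjMatrix, Set.ncard_eq_toFinset_card']

theorem sum_adjMatrix_pow_succ [Fintype V] [DecidableEq V] [Fintype A] (n : ℕ) (v : V) :
    ∑ w, (G.adjMatrix ^ (n + 1)) v w = ∑ q ∈ G.exits v, ∑ w, (G.adjMatrix ^ n) q.1 w := by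
  rw [G.sum_exits v fun u => ∑ w, (G.adjMatrix ^ n) u w, pow_succ']
  simp only [Matrix.mul_apply, Finset.mul_sum, Nat.cast_id]
  exact Finset.sum_comm

variable (p : ℕ) [Fact p.Prime] (f : A → Fin p)

/-- The digit image of the path set at `v` is covered by as many balls of radius `p ^ (-n)` as there
are walks of length `n` issuing from `v`. -/
theorem exists_finset_cover [Fintype V] [DecidableEq V] [Fintype A] (n : ℕ) :
    ∀ v : V, ∃ T : Finset ℤ_[p], T.card ≤ ∑ w, (G.adjMatrix ^ n) v w ∧
      digitExpansion p f '' G.pathSet v ⊆ ⋃ y ∈ T, Metric.closedBall y (((p : ℝ)⁻¹) ^ n) := by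
  classical
  induction n with
  | zero =>
    refine fun v => ⟨{0}, by simp [Matrix.one_apply], fun x _ => ?_⟩
    simpa using PadicInt.norm_le_one x
  | succ n ih =>
    choose T hT hcov using ih
    intro v
    refine ⟨(G.exits v).biUnion fun q =>
      (T q.1).image fun y => ((f q.2 : ℕ) : ℤ_[p]) + p * y, ?_, ?_⟩
    · calc _ ≤ ∑ q ∈ G.exits v, ∑ w, (G.adjMatrix ^ n) q.1 w :=
            Finset.card_biUnion_le.trans
              (Finset.sum_le_sum fun q _ => Finset.card_image_le.trans (hT q.1))
        _ = ∑ w, (G.adjMatrix ^ (n + 1)) v w :=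
            (G.sum_adjMatrix_pow_succ n v).symm
    · rintro _ ⟨a, ha, rfl⟩
      obtain ⟨w, hw, hb⟩ := G.exists_edge_of_mem_pathSet ha
      have := hcov w (Set.mem_image_of_mem _ hb)
      simp only [Set.mem_iUnion, Metric.mem_closedBall, exists_prop] at this ⊢
      obtain ⟨y, hy, hd⟩ := this
      refine ⟨((f (a 0) : ℕ) : ℤ_[p]) + p * y, ?_, ?_⟩
      · rw [Finset.mem_biUnion]
        exact ⟨(w, a 0), G.mem_exits.2 hw, Finset.mem_image_of_mem _ hy⟩
      · rw [digitExpansion_eq_head_add, dist_eq_norm, add_sub_add_left_eq_sub, ← mul_sub,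
          PadicInt.norm_p_mul, pow_succ', ← dist_eq_norm]
        gcongr

/-- Prepending the label `a` embeds one image in the other by an antilipschitz map, which cannot
lower dimension. -/
theorem dimH_image_le_of_edge {v w : V} {a : A} (h : (v, w, a) ∈ G.edges) :
    dimH (digitExpansion p f '' G.pathSet w) ≤ dimH (digitExpansion p f '' G.pathSet v) := by
  refine ((antilipschitzWith_add_p_mul p ((f a : ℕ) : ℤ_[p])).le_dimH_image _).trans (dimH_mono ?_)
  rintro _ ⟨_, ⟨b, hb, rfl⟩, rfl⟩
  exact ⟨_, G.cons_mem_pathSet h hb, digitExpansion_eq_head_add p f _⟩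

theorem dimH_image_le_of_reachable {v : V} (h : G.Reachable v) (w : V) :
    dimH (digitExpansion p f '' G.pathSet w) ≤ dimH (digitExpansion p f '' G.pathSet v) := by
  induction h w with
  | refl => exact le_rfl
  | tail _ hbc ih =>
    obtain ⟨a, ha⟩ := hbc
    exact (G.dimH_image_le_of_edge p f ha).trans ih

end LabeledDigraph

/-! ### Lower bound: the greedy walk and the Hausdorff measure. -/

namespace LabeledDigraph

variable {V A : Type*} (G : LabeledDigraph V A)

/-- If `x` is subinvariant for the adjacency matrix, a weight on the alphabet whose total is below
`σ * x v` is beaten by some edge leaving `v`. -/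
theorem exists_edge_lt [Fintype V] [Fintype A] (hG : G.RightResolving) {σ : ℝ≥0∞} {x : V → ℝ≥0∞}
    (hx : ∀ v, σ * x v ≤ ∑ w, (G.adjMatrix v w : ℝ≥0∞) * x w) {v : V} {c : A → ℝ≥0∞}
    (hc : ∑ a, c a < σ * x v) : ∃ w a, (v, w, a) ∈ G.edges ∧ c a < x w := by
  classical
  by_contra! hcon
  refine (hc.trans_le (hx v)).not_ge ?_
  rw [← G.sum_exits]
  calc ∑ q ∈ G.exits v, x q.1 ≤ ∑ q ∈ G.exits v, c q.2 :=
        Finset.sum_le_sum fun q hq => hcon _ _ (G.mem_exits.1 hq)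
    -- Right-resolving: each label is counted at most once among the exits.
    _ = ∑ a ∈ (G.exits v).image Prod.snd, c a := by
        rw [Finset.sum_image]
        rintro ⟨w, a⟩ h1 ⟨w', a'⟩ h2 (rfl : a = a')
        rw [Finset.mem_coe, mem_exits] at h1 h2
        exact Prod.ext (hG _ _ _ _ h1 h2) rfl
    _ ≤ ∑ a, c a := Finset.sum_le_sum_of_subset (Finset.subset_univ _)

/-- A greedy infinite walk: given sequences `z i` with weights `γ i` of total less than `x v`, some
label sequence of a walk from `v` shares only a prefix of length `n` with `γ i * σ ^ n < M` with
every `z i`. -/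
theorem exists_mem_pathSet_avoiding [Fintype V] [Fintype A] (hG : G.RightResolving) {σ M : ℝ≥0∞}
    (hσ0 : σ ≠ 0) (hσ : σ ≠ ∞) {x : V → ℝ≥0∞} (hM : ∀ v, x v ≤ M)
    (hx : ∀ v, σ * x v ≤ ∑ w, (G.adjMatrix v w : ℝ≥0∞) * x w) {ι : Type*} (z : ι → ℕ → A)
    (γ : ι → ℝ≥0∞) {v : V} (hγ : ∑' i, γ i < x v) :
    ∃ a ∈ G.pathSet v, ∀ i n, (∀ k < n, z i k = a k) → γ i * σ ^ n < M := by
  classical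
  -- State: position, vertex, current weights, with total weight below `x` at the vertex. After each
  -- letter the weight of a sequence that still agrees is multiplied by `σ`, and any other weight
  -- becomes `0`.
  let S := {q : ℕ × V × (ι → ℝ≥0∞) // ∑' i, q.2.2 i < x q.2.1}
  have step : ∀ q : S, ∃ (a : A) (q' : S), (q.1.2.1, q'.1.2.1, a) ∈ G.edges ∧
      q'.1.1 = q.1.1 + 1 ∧
      ∀ i, q'.1.2.2 i = if z i q.1.1 = a then σ * q.1.2.2 i else 0 := by
    rintro ⟨⟨k, u, δ⟩, hδ⟩
    -- Each `i` contributes to the single label `z i k`, so the total over labels is `σ * ∑ δ`.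
    have hsum : ∑ a, ∑' i, (if z i k = a then σ * δ i else 0) < σ * x u := by
      rw [← tsum_fintype (L := .unconditional _), ENNReal.tsum_comm]
      simp only [tsum_fintype, Finset.sum_ite_eq, Finset.mem_univ, if_true]
      rw [ENNReal.tsum_mul_left]
      exact (ENNReal.mul_lt_mul_iff_right hσ0 hσ).2 hδ
    obtain ⟨w, a, he, hlt⟩ := G.exists_edge_lt hG hx hsum
    exact ⟨a, ⟨⟨k + 1, w, _⟩, hlt⟩, he, rfl, fun i => rfl⟩
  choose lab next hedge hnum hwt using step
  let s : ℕ → S := fun n => next^[n] ⟨⟨0, v, γ⟩, hγ⟩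
  have hs : ∀ n, s (n + 1) = next (s n) := fun n => Function.iterate_succ_apply' _ _ _
  have hk : ∀ n, (s n).1.1 = n := fun n => by
    induction n with
    | zero => rfl
    | succ n ih => rw [hs, hnum, ih]
  refine ⟨fun n => lab (s n), ⟨fun n => (s n).1.2.1, rfl, fun n => ?_⟩, fun i n hin => ?_⟩
  · simp only [hs]
    exact hedge _
  · have key : (s n).1.2.2 i = γ i * σ ^ n := by
      induction n with
      | zero => simp [s]
      | succ n ih =>
        rw [hs, hwt, hk, if_pos (hin n (by omega)), ih fun k hk => hin k (by omega)]
        ring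
    rw [← key]
    exact (ENNReal.le_tsum i).trans_lt ((s n).2.trans_le (hM _))

/-- A vertex charged by a subinvariant vector for `σ = p ^ s` has a digit image of positive
`s`-dimensional Hausdorff measure. -/
theorem hausdorffMeasure_image_ne_zero [Fintype V] [Fintype A] [Nonempty A] (p : ℕ)
    [Fact p.Prime] {f : A → Fin p} (hf : Function.Injective f) (hG : G.RightResolving)
    {σ : ℝ≥0} (hσ : 1 < σ) {s : ℝ} (hs : 0 < s) (hps : (p : ℝ≥0) ^ s = σ) {x : V → ℝ≥0}
    (hx : ∀ v, σ * x v ≤ ∑ w, (G.adjMatrix v w : ℝ≥0) * x w) {v : V} (hv : x v ≠ 0)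
    [MeasurableSpace ℤ_[p]] [BorelSpace ℤ_[p]] :
    μH[s] (digitExpansion p f '' G.pathSet v) ≠ 0 := by
  classical
  have hσ0 : (σ : ℝ≥0∞) ≠ 0 := by
    simpa using (zero_lt_one.trans hσ).ne'
  set M : ℝ≥0 := Finset.univ.sup x
  have hxM : ∀ w, x w ≤ M := fun w => Finset.le_sup (Finset.mem_univ w)
  have hM0 : (M : ℝ≥0∞) ≠ 0 := by
    simpa using ((pos_iff_ne_zero.2 hv).trans_le (hxM v)).ne'
  -- Lower bound to be proved for the measure; the factor `σ` pays for rounding a diameter to a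
  -- power of `p`.
  set κ : ℝ≥0∞ := x v / (M * σ) with hκ
  have hMσ0 : (M * σ : ℝ≥0∞) ≠ 0 := mul_ne_zero hM0 hσ0
  have hMσt : (M * σ : ℝ≥0∞) ≠ ∞ := by finiteness
  have hκ0 : κ ≠ 0 := by
    simp [hκ, hv, hMσt]
  refine fun h0 => hκ0 (le_antisymm (h0 ▸ ?_) zero_le)
  rw [Measure.hausdorffMeasure_apply]
  refine le_iSup₂_of_le (1 : ℝ≥0∞) one_pos (le_iInf fun t => le_iInf fun hcov => le_iInf fun _ => ?_)
  by_contra! hlt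
  set d : ℕ → ℝ≥0∞ := fun i => ⨆ _ : (t i).Nonempty, Metric.ediam (t i) ^ s with hd
  -- The `ε i` keep sizes positive, so that pieces of diameter zero also get a finite prefix length.
  obtain ⟨ε, hε0, hε⟩ := ENNReal.exists_pos_sum_of_countable (tsub_pos_of_lt hlt).ne' ℕ
  have hsum : ∑' i, M * σ * (d i + ε i) < (x v : ℝ≥0∞) := by
    rw [ENNReal.tsum_mul_left, ENNReal.tsum_add, mul_comm,
      ← ENNReal.lt_div_iff_mul_lt (.inl hMσ0) (.inl hMσt), add_comm]
    exact lt_tsub_iff_right.1 hε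
  have hzn : ∀ i, ∃ (z : ℕ → A) (n : ℕ), 1 ≤ σ * (d i + ε i) * σ ^ n ∧
      ∀ a, digitExpansion p f a ∈ t i → ∀ k < n, z k = a k := by
    intro i
    by_cases hne : ∃ z, digitExpansion p f z ∈ t i
    swap
    · obtain ⟨e, he⟩ : ∃ e : ℝ≥0, 0 < e ∧ (e : ℝ≥0∞) ≤ d i + ε i := ⟨ε i, hε0 i, le_add_self⟩
      obtain ⟨n, hn⟩ := pow_unbounded_of_one_lt e⁻¹ hσ
      refine ⟨fun _ => Classical.arbitrary A, n, ?_, fun a ha => (hne ⟨a, ha⟩).elim⟩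
      have h1 : (1 : ℝ≥0) ≤ σ * e * σ ^ n := by
        have h2 : 1 ≤ e * σ ^ n := by
          rw [← inv_le_iff_one_le_mul₀' he.1]
          exact hn.le
        calc (1 : ℝ≥0) ≤ 1 * (e * σ ^ n) := by simpa using h2
          _ ≤ σ * (e * σ ^ n) := by gcongr
          _ = _ := by ring
      calc (1 : ℝ≥0∞) ≤ σ * e * σ ^ n := by exact_mod_cast h1
        _ ≤ _ := by gcongr; exact he.2
    obtain ⟨z, hz⟩ := hne
    by_cases he1 : 1 ≤ d i + ε i
    · refine ⟨z, 0, ?_, fun a ha k hk => by omega⟩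
      rw [pow_zero, mul_one]
      exact one_le_mul (by exact_mod_cast hσ.le) he1
    · push Not at he1
      obtain ⟨e, he⟩ : ∃ e : ℝ≥0, (e : ℝ≥0∞) = d i + ε i :=
        ⟨_, ENNReal.coe_toNNReal (he1.trans ENNReal.one_lt_top).ne⟩
      rw [← he] at he1 ⊢
      have he0 : 0 < e := by
        have : (ε i : ℝ≥0∞) ≤ e := he ▸ le_add_self
        exact (hε0 i).trans_le (by exact_mod_cast this)
      -- `σ⁻¹ ^ (n + 1) < e ≤ σ⁻¹ ^ n`: the right half bounds the diameter by `p ^ (-n)`, the left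
      -- half gives the weight estimate.
      obtain ⟨n, hn1, hn2⟩ := exists_nat_pow_near_of_lt_one he0 (by exact_mod_cast he1.le)
        (inv_pos.2 (zero_lt_one.trans hσ)) (inv_lt_one_of_one_lt₀ hσ)
      refine ⟨z, n, ?_, fun a ha => ?_⟩
      · have h1 : (1 : ℝ≥0) ≤ σ * e * σ ^ n := by
          have h2 : 1 ≤ e * σ ^ (n + 1) := by
            rw [← inv_le_iff_one_le_mul₀ (by positivity), ← inv_pow]
            exact hn1.le
          calc (1 : ℝ≥0) ≤ e * σ ^ (n + 1) := h2
            _ = _ := by ring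
        exact_mod_cast h1
      · apply eq_of_norm_digitExpansion_sub_le p hf n
        have hdi : Metric.ediam (t i) ^ s ≤ ((((p : ℝ≥0)⁻¹) ^ n : ℝ≥0) : ℝ≥0∞) ^ s := by
          calc Metric.ediam (t i) ^ s = d i := by rw [hd]; simp [show (t i).Nonempty from ⟨_, hz⟩]
            _ ≤ e := he ▸ le_self_add
            _ ≤ ((σ⁻¹ ^ n : ℝ≥0) : ℝ≥0∞) := by exact_mod_cast hn2
            _ = _ := by
              rw [← ENNReal.coe_rpow_of_nonneg _ hs.le, ← hps, ← NNReal.inv_rpow,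
                ← NNReal.rpow_natCast, ← NNReal.rpow_natCast, ← NNReal.rpow_mul,
                ← NNReal.rpow_mul, mul_comm]
        have h3 := (Metric.edist_le_ediam_of_mem hz ha).trans ((ENNReal.rpow_le_rpow_iff hs).1 hdi)
        rw [edist_nndist, ENNReal.coe_le_coe, ← NNReal.coe_le_coe, coe_nndist, dist_eq_norm] at h3
        simpa using h3
  choose z n hn hz using hzn
  obtain ⟨a, ha, hav⟩ := G.exists_mem_pathSet_avoiding hG hσ0 ENNReal.coe_ne_top
    (x := fun w => (x w : ℝ≥0∞)) (M := M) (fun w => by exact_mod_cast hxM w)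
    (fun w => by exact_mod_cast hx w) z (fun i => M * σ * (d i + ε i)) hsum
  obtain ⟨i, hi⟩ := Set.mem_iUnion.1 (hcov (Set.mem_image_of_mem _ ha))
  -- The covering piece containing the point forces agreement with `z i` up to `n i`, where the
  -- weight already reaches `M`.
  refine (hav i (n i) (hz i a hi)).not_ge ?_
  calc (M : ℝ≥0∞) = M * 1 := (mul_one _).symm
    _ ≤ M * (σ * (d i + ε i) * σ ^ n i) := by gcongr; exact hn i
    _ = _ := by ring

end LabeledDigraph

/-! ### Spectral radius: row sums of powers and a subinvariant vector. -/

section Spectral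
attribute [local instance] Matrix.linftyOpNormedRing Matrix.linftyOpNormedAlgebra

variable {V : Type*} [Fintype V] [DecidableEq V]

/-- The row sums of the powers of a matrix of natural numbers grow at most like `r ^ n`, for every
`r` beyond the spectral radius. -/
theorem Matrix.eventually_sum_pow_row_le (B : Matrix V V ℕ) {r : ℝ≥0}
    (hr : spectralRadius ℂ (B.map (Nat.cast : ℕ → ℂ)) < r) :
    ∀ᶠ n : ℕ in atTop, ∀ v, ((∑ w, (B ^ n) v w : ℕ) : ℝ≥0∞) ≤ (r : ℝ≥0∞) ^ n := by
  set C : Matrix V V ℂ := B.map (Nat.cast : ℕ → ℂ) with hC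
  have hpow : ∀ n v w, (C ^ n) v w = ((B ^ n) v w : ℂ) := fun n v w => by
    have : C ^ n = (B ^ n).map (Nat.cast : ℕ → ℂ) := by
      rw [hC]
      exact (map_pow (Nat.castRingHom ℂ).mapMatrix B n).symm
    rw [this, Matrix.map_apply]
  -- Gelfand's formula in the operator norm that equals the largest absolute row sum.
  filter_upwards [(spectrum.pow_nnnorm_pow_one_div_tendsto_nhds_spectralRadius C).eventually_lt_const
    hr, eventually_gt_atTop 0] with n hn hn0 v
  have h1 : (‖C ^ n‖₊ : ℝ≥0∞) ≤ (r : ℝ≥0∞) ^ n := by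
    have := ENNReal.rpow_le_rpow hn.le (Nat.cast_nonneg n : (0 : ℝ) ≤ n)
    rwa [← ENNReal.rpow_mul, one_div_mul_cancel (by positivity), ENNReal.rpow_one,
      ENNReal.rpow_natCast] at this
  refine le_trans ?_ h1
  rw [Matrix.linfty_opNNNorm_def]
  have h2 := Finset.le_sup (f := fun i => ∑ j, ‖(C ^ n) i j‖₊) (Finset.mem_univ v)
  refine le_trans (le_of_eq ?_) (ENNReal.coe_le_coe.2 h2)
  simp [hpow]

/-- The moduli of an eigenvector for an eigenvalue of maximal modulus form a subinvariant vector: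
this replaces the Perron vector. -/
theorem Matrix.exists_subinvariant_vector [Nonempty V] (B : Matrix V V ℕ) :
    ∃ (σ : ℝ≥0) (x : V → ℝ≥0), spectralRadius ℂ (B.map (Nat.cast : ℕ → ℂ)) = σ ∧ x ≠ 0 ∧
      ∀ v, σ * x v ≤ ∑ w, (B v w : ℝ≥0) * x w := by
  obtain ⟨z, hz, hzr⟩ := spectrum.exists_nnnorm_eq_spectralRadius (B.map (Nat.cast : ℕ → ℂ))
  rw [← Matrix.spectrum_toLin', ← Module.End.hasEigenvalue_iff_mem_spectrum] at hz
  obtain ⟨y, hy⟩ := hz.exists_hasEigenvector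
  refine ⟨‖z‖₊, fun v => ‖y v‖₊, hzr.symm, fun h => hy.2 ?_, fun v => ?_⟩
  · ext v
    simpa using congrFun h v
  · have h1 := congrFun hy.apply_eq_smul v
    rw [Matrix.toLin'_apply] at h1
    rw [← nnnorm_mul, ← smul_eq_mul, ← Pi.smul_apply, ← h1]
    refine (nnnorm_sum_le _ _).trans (le_of_eq ?_)
    simp

end Spectral

/-! ### Upper bound and conclusion. -/

namespace LabeledDigraph

variable {V A : Type*} (G : LabeledDigraph V A) [Fintype V] [DecidableEq V] [Fintype A]
  (p : ℕ) [Fact p.Prime] (f : A → Fin p)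

/-- For `r` strictly between the spectral radius and `p ^ s`, the covers have `s`-size at most `(r *
p ^ (-s)) ^ n`, which tends to `0`. Ultrametricity bounds a ball's diameter by its radius. -/
theorem dimH_image_le {s : ℝ≥0} (hs : spectralRadius ℂ (G.adjMatrix.map (Nat.cast : ℕ → ℂ)) <
    ((p : ℝ≥0) ^ (s : ℝ) : ℝ≥0)) (v : V) : dimH (digitExpansion p f '' G.pathSet v) ≤ s := by
  borelize ℤ_[p]
  have hp : (1 : ℝ) < p := by exact_mod_cast (Fact.out : p.Prime).one_lt
  obtain ⟨r, hr1, hr2⟩ := ENNReal.lt_iff_exists_nnreal_btwn.1 hs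
  rw [ENNReal.coe_lt_coe] at hr2
  refine dimH_le_of_hausdorffMeasure_ne_top (d := s) (ne_top_of_le_ne_top ENNReal.zero_ne_top ?_)
  choose T hT hcov using fun n => G.exists_finset_cover p f n v
  set q : ℝ≥0 := (p : ℝ≥0)⁻¹ with hq
  have hq1 : q < 1 := inv_lt_one_of_one_lt₀ (by exact_mod_cast hp)
  have hdiam : ∀ n (y : ℤ_[p]),
      Metric.ediam (Metric.closedBall y (((p : ℝ)⁻¹) ^ n)) ≤ ((q ^ n : ℝ≥0) : ℝ≥0∞) := by
    refine fun n y => Metric.ediam_le fun a ha b hb => ?_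
    rw [edist_nndist, ENNReal.coe_le_coe, ← NNReal.coe_le_coe, coe_nndist]
    have : (((q ^ n : ℝ≥0)) : ℝ) = ((p : ℝ)⁻¹) ^ n := by simp [hq]
    rw [this]
    rw [Metric.mem_closedBall] at ha hb
    rw [dist_comm] at hb
    rw [dist_eq_norm] at *
    have e : a - b = (a - y) + (y - b) := by ring
    rw [e]
    exact (PadicInt.nonarchimedean _ _).trans (max_le ha hb)
  have hlim := Measure.hausdorffMeasure_le_liminf_sum (s : ℝ)
    (digitExpansion p f '' G.pathSet v) (l := atTop) (fun n => ((q ^ n : ℝ≥0) : ℝ≥0∞))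
    (ENNReal.tendsto_coe.2 (NNReal.tendsto_pow_atTop_nhds_zero_of_lt_one hq1))
    (ι := fun n => T n) (fun n y => Metric.closedBall (y : ℤ_[p]) (((p : ℝ)⁻¹) ^ n))
    (Eventually.of_forall fun n y => hdiam n y)
    (Eventually.of_forall fun n => by simpa [Set.iUnion_subtype] using hcov n)
  refine hlim.trans (le_of_eq (Tendsto.liminf_eq ?_))
  have hrq : r * q ^ (s : ℝ) < 1 := by
    rw [hq, NNReal.inv_rpow, ← div_eq_mul_inv, div_lt_one (pos_of_gt hr2)]
    exact hr2
  refine tendsto_of_tendsto_of_tendsto_of_le_of_le' tendsto_const_nhds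
    (h := fun n => (((r * q ^ (s : ℝ)) ^ n : ℝ≥0) : ℝ≥0∞))
    (ENNReal.tendsto_coe.2 (NNReal.tendsto_pow_atTop_nhds_zero_of_lt_one hrq))
    (Eventually.of_forall fun n => zero_le) ?_
  filter_upwards [Matrix.eventually_sum_pow_row_le G.adjMatrix hr1] with n hn
  calc _ ≤ ∑ _y : T n, ((q ^ n : ℝ≥0) : ℝ≥0∞) ^ (s : ℝ) :=
        Finset.sum_le_sum fun y _ => ENNReal.rpow_le_rpow (hdiam n y) s.2
    _ = (T n).card * ((q ^ n : ℝ≥0) : ℝ≥0∞) ^ (s : ℝ) := by simp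
    _ ≤ (r : ℝ≥0∞) ^ n * ((q ^ n : ℝ≥0) : ℝ≥0∞) ^ (s : ℝ) := by
        gcongr
        exact (Nat.cast_le.2 (hT n)).trans (hn v)
    _ = _ := by
        rw [← ENNReal.coe_rpow_of_nonneg _ s.coe_nonneg, mul_pow, ENNReal.coe_mul, ENNReal.coe_pow,
          ← NNReal.rpow_natCast, ← NNReal.rpow_natCast, ← NNReal.rpow_mul, ← NNReal.rpow_mul,
          mul_comm (n : ℝ)]

/-- A graph that carries an infinite walk has spectral radius at least one. -/
theorem one_le_spectralRadius {v : V} (hv : (G.pathSet v).Nonempty) :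
    1 ≤ spectralRadius ℂ (G.adjMatrix.map (Nat.cast : ℕ → ℂ)) := by
  by_contra! hlt
  obtain ⟨r, hr1, hr2⟩ := ENNReal.lt_iff_exists_nnreal_btwn.1 hlt
  obtain ⟨n, hn, hn0⟩ :=
    ((Matrix.eventually_sum_pow_row_le G.adjMatrix hr1).and (eventually_gt_atTop 0)).exists
  have hpos : ∀ (m : ℕ) (u : V), (G.pathSet u).Nonempty → 1 ≤ ∑ w, (G.adjMatrix ^ m) u w := by
    intro m
    induction m with
    | zero => simp [Matrix.one_apply]
    | succ m ih =>
      rintro u ⟨a, ha⟩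
      obtain ⟨w, hw, hb⟩ := G.exists_edge_of_mem_pathSet ha
      calc 1 ≤ ∑ j, (G.adjMatrix ^ m) w j := ih w ⟨_, hb⟩
        _ ≤ ∑ q ∈ G.exits u, ∑ j, (G.adjMatrix ^ m) q.1 j :=
            Finset.single_le_sum (f := fun q : V × A => ∑ j, (G.adjMatrix ^ m) q.1 j)
              (fun _ _ => Nat.zero_le _) (G.mem_exits (q := (w, a 0)).2 hw)
        _ = ∑ j, (G.adjMatrix ^ (m + 1)) u j := (G.sum_adjMatrix_pow_succ m u).symm
  have h1 : (1 : ℝ≥0∞) ≤ (r : ℝ≥0∞) ^ n :=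
    le_trans (by exact_mod_cast hpos n v hv) (hn v)
  exact h1.not_gt (pow_lt_one₀ zero_le hr2 hn0.ne')

end LabeledDigraph

theorem theorem1p1 (p : ℕ) [Fact p.Prime] {V A : Type*} [Fintype V] [DecidableEq V] [Finite A]
    (Y : Set ℤ_[p]) (hY : Y.Nonempty) (f : A → Fin p) (G : LabeledDigraph V A) (v₀ : V)
    (h : IsStandardPresentation p Y f G v₀) :
    ((dimH Y : ℝ≥0∞) : EReal) =
      ENNReal.log (spectralRadius ℂ (G.adjMatrix.map (Nat.cast : ℕ → ℂ))) /
        ((Real.log p : ℝ) : EReal) := by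
  cases nonempty_fintype A
  have hp : (1 : ℝ) < p := by exact_mod_cast (Fact.out : p.Prime).one_lt
  have hlogp : 0 < Real.log p := Real.log_pos hp
  have hX : (G.pathSet v₀).Nonempty := by
    rw [h.eq_image] at hY
    exact hY.of_image
  have : Nonempty A := ⟨hX.some 0⟩
  have : Nonempty V := ⟨v₀⟩
  obtain ⟨σ, x, hσ, hx0, hx⟩ := Matrix.exists_subinvariant_vector G.adjMatrix
  have hσ1 : 1 ≤ σ := by
    have := G.one_le_spectralRadius hX
    rw [hσ] at this
    exact_mod_cast this
  have hσpos : (0 : ℝ) < σ := by exact_mod_cast zero_lt_one.trans_le hσ1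
  set D : ℝ≥0 := ⟨Real.log σ / Real.log p, div_nonneg (Real.log_nonneg (by exact_mod_cast hσ1))
    hlogp.le⟩
  have hpD : (p : ℝ≥0) ^ (D : ℝ) = σ := by
    apply NNReal.coe_injective
    rw [NNReal.coe_rpow, NNReal.coe_natCast]
    exact Real.rpow_logb (zero_lt_one.trans hp) hp.ne' hσpos
  have hdim : dimH Y = D := by
    rw [h.eq_image]
    refine le_antisymm (le_of_forall_gt fun c hc => ?_) ?_
    · obtain ⟨s, hDs, hsc⟩ := ENNReal.lt_iff_exists_nnreal_btwn.1 hc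
      refine (G.dimH_image_le p f ?_ v₀).trans_lt hsc
      rw [hσ, ENNReal.coe_lt_coe, ← hpD]
      exact NNReal.rpow_lt_rpow_of_exponent_lt (by exact_mod_cast hp) (by exact_mod_cast hDs)
    -- The measure argument needs `σ > 1`; for `σ = 1` the lower bound is zero.
    · rcases hσ1.eq_or_lt with h1 | h1
      · have : D = 0 := by
          apply NNReal.coe_injective
          change Real.log σ / Real.log p = 0
          simp [← h1]
        simp [this]
      · obtain ⟨v, hv⟩ := Function.ne_iff.1 hx0
        borelize ℤ_[p]
        have hDpos : (0 : ℝ) < D := div_pos (Real.log_pos (by exact_mod_cast h1)) hlogp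
        exact (le_dimH_of_hausdorffMeasure_ne_zero
          (G.hausdorffMeasure_image_ne_zero p h.injective h.rightResolving h1 hDpos hpD hx hv)).trans
          (G.dimH_image_le_of_reachable p f h.reachable v)
  rw [hdim, hσ, ENNReal.log_pos_real (by exact_mod_cast hσpos.ne') ENNReal.coe_ne_top,
    ENNReal.coe_toReal, ← EReal.coe_div]
  rfl
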